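/- Let $e \ge 1$ and $r \ge 2$ be integers, and let $B^{\oplus}(e,e,r)$ be the monoid presented by the generators $t_i$ ($i \in \mathbb{Z}/e$) and $s_3, \dots, s_r$, subject to the relations - $s_i s_j s_i = s_j s_i s_j$ for $3 \le i,j \le r$, $|i-j| = 1$; - $s_i s_j = s_j s_i$ for $3 \le i,j \le r$, $|i-j| > 1$; - $s_3 t_i s_3 = t_i s_3 t_i$ for $i \in \mathbb{Z}/e$ (if $r \ge 3$); - $s_j t_i = t_i s_j$ for $i \in \mathbb{Z}/e$ and $4 \le j \le r$; - $t_i t_{i-1} = t_j t_{j-1}$ for $i, j \in \mathbb{Z}/e$. Let $\tau = t_i t_{i-1}$ (which does not depend on $i$), $\Lambda_2 = \tau$, $\Lambda_p = s_p \cdots s_3\, \tau\, s_3 \cdots s_p$ for $3 \le p \le r$, and $\Delta = \Lambda_2 \Lambda_3 \cdots \Lambda_r$. In a monoid, $x$ left-divides (resp. right-divides) $y$ if $y = xz$ (resp. $y = zx$) for some $z$. A right lcm of a set is a common right multiple (an element left-divisible by all members of the set) that left-divides every common right multiple; a left gcd is a common left divisor that is left-divisible by every common left divisor; left lcm's and right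 gcd's are defined symmetrically. A Garside element of a monoid is an element whose left and right divisors coincide, are finite in number and generate the monoid. A Garside monoid is a cancellative monoid with no invertible element other than $1$ in which any two elements have left and right lcm's and left and right gcd's, and which has a Garside element. Then $B^{\oplus}(e,e,r)$ is a Garside monoid, and $\Delta$ is a Garside element of it. If moreover $e \ge 2$, then $\Delta$ is both the right lcm and the left lcm of the set of generators $\{t_i \mid i \in \mathbb{Z}/e\} \cup \{s_3, \dots, s_r\}$, and it is the minimal Garside element: $\Delta$ left-divides every Garside element of $B^{\oplus}(e,e,r)$. -/

import Mathlib

namespace Garside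

section Divisibility

variable {M : Type*} [Monoid M]

/-- `x` right-divides `y`, i.e. `y = z * x` for some `z`.
(`x` left-divides `y`, i.e. `y = x * z` for some `z`, is Mathlib's `x ∣ y`.) -/
def RightDvd (x y : M) : Prop := ∃ z, y = z * x

/-- `m` is a right lcm of `S`: a least common right multiple, for left divisibility. -/
def IsRightLcm (S : Set M) (m : M) : Prop :=
  (∀ x ∈ S, x ∣ m) ∧ ∀ n, (∀ x ∈ S, x ∣ n) → m ∣ n

/-- `m` is a left lcm of `S`: a least common left multiple, for right divisibility. -/
def IsLeftLcm (S : Set M) (m : M) : Prop :=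
  (∀ x ∈ S, RightDvd x m) ∧ ∀ n, (∀ x ∈ S, RightDvd x n) → RightDvd m n

/-- `d` is a left gcd of `S`: a greatest common left divisor. -/
def IsLeftGcd (S : Set M) (d : M) : Prop :=
  (∀ x ∈ S, d ∣ x) ∧ ∀ c, (∀ x ∈ S, c ∣ x) → c ∣ d

/-- `d` is a right gcd of `S`: a greatest common right divisor. -/
def IsRightGcd (S : Set M) (d : M) : Prop :=
  (∀ x ∈ S, RightDvd d x) ∧ ∀ c, (∀ x ∈ S, RightDvd c x) → RightDvd c d

/-- A Garside element: its left and right divisors coincide, are finite in number and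
generate the monoid. -/
structure IsGarsideElement (g : M) : Prop where
  balanced : ∀ x, x ∣ g ↔ RightDvd x g
  finite : {x : M | x ∣ g}.Finite
  generates : Submonoid.closure {x : M | x ∣ g} = ⊤

end Divisibility

/-- A Garside monoid: a cancellative monoid with (left and right) lcm's and gcd's, admitting a
Garside element. The condition on units is what makes lcm's and gcd's unique, i.e. well-defined
elements of the monoid. -/
structure IsGarsideMonoid (M : Type*) [Monoid M] : Prop where
  cancel : IsCancelMul M
  eq_one_of_isUnit : ∀ u : M, IsUnit u → u = 1
  exists_rightLcm : ∀ x y : M, ∃ m, IsRightLcm {x, y} m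
  exists_leftLcm : ∀ x y : M, ∃ m, IsLeftLcm {x, y} m
  exists_leftGcd : ∀ x y : M, ∃ d, IsLeftGcd {x, y} d
  exists_rightGcd : ∀ x y : M, ∃ d, IsRightGcd {x, y} d
  exists_garsideElement : ∃ g : M, IsGarsideElement g

/-- The generators `t_i` for `i ∈ ℤ/e`, and `s_3, …, s_r`. -/
inductive Gen (e r : ℕ) : Type
  | t (i : ZMod e) : Gen e r
  | s (j : Set.Icc 3 r) : Gen e r

section Presentation

open FreeMonoid (of)
open Gen

/-- The defining relations of type `(e, e, r)`. -/
inductive Rel (e r : ℕ) : FreeMonoid (Gen e r) → FreeMonoid (Gen e r) → Prop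
  | R1 (i j : Set.Icc 3 r) (h : |((i : ℕ) : ℤ) - ((j : ℕ) : ℤ)| = 1) :
      Rel e r (of (s i) * of (s j) * of (s i)) (of (s j) * of (s i) * of (s j))
  | R2 (i j : Set.Icc 3 r) (h : 1 < |((i : ℕ) : ℤ) - ((j : ℕ) : ℤ)|) :
      Rel e r (of (s i) * of (s j)) (of (s j) * of (s i))
  | R3 (j : Set.Icc 3 r) (h : (j : ℕ) = 3) (i : ZMod e) :
      Rel e r (of (s j) * of (t i) * of (s j)) (of (t i) * of (s j) * of (t i))
  | R4 (j : Set.Icc 3 r) (h : 4 ≤ (j : ℕ)) (i : ZMod e) :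
      Rel e r (of (s j) * of (t i)) (of (t i) * of (s j))
  | R5 (i j : ZMod e) :
      Rel e r (of (t i) * of (t (i - 1))) (of (t j) * of (t (j - 1)))

end Presentation

/-- The monoid `B⊕(e, e, r)` with generators `Gen e r` and relations `Rel e r`. -/
abbrev BraidMonoid (e r : ℕ) : Type := PresentedMonoid (Rel e r)

/-- The element `t_i` of the monoid. -/
def t (e r : ℕ) (i : ZMod e) : BraidMonoid e r := PresentedMonoid.of (Rel e r) (Gen.t i)

/-- The element `s_j` of the monoid, for `3 ≤ j ≤ r`. -/
def s (e r : ℕ) (j : ℕ) (h3 : 3 ≤ j) (hr : j ≤ r) : BraidMonoid e r :=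
  PresentedMonoid.of (Rel e r) (Gen.s ⟨j, h3, hr⟩)

/-- The element `τ = t_1 t_0`, equal to `t_i t_{i-1}` for every `i` by relation `R5`. -/
def tau (e r : ℕ) : BraidMonoid e r := t e r 1 * t e r 0

/-- `Lam e r k _` is `Λ_{k+2}`: `Λ_2 = τ` and `Λ_p = s_p ⋯ s_3 τ s_3 ⋯ s_p` for `3 ≤ p ≤ r`. -/
def Lam (e r : ℕ) : (k : ℕ) → k + 2 ≤ r → BraidMonoid e r
  | 0, _ => tau e r
  | k + 1, h =>
      s e r (k + 3) (by omega) (by omega) * Lam e r k (by omega) *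
        s e r (k + 3) (by omega) (by omega)

/-- `Δ = Λ_2 Λ_3 ⋯ Λ_r`. -/
def Delta (e r : ℕ) : BraidMonoid e r :=
  (List.ofFn fun k : Fin (r - 1) => Lam e r k (by omega)).prod

/-- The set `T_e ∪ S_r` of the generators, as elements of the monoid. -/
def generators (e r : ℕ) : Set (BraidMonoid e r) := Set.range (PresentedMonoid.of (Rel e r))

end Garside

/-! The relations are homogeneous, so word length is additive. Two distinct generators have exactly
one relation of the form `a u = b v`: a commutation, a braid relation or `t_i t_{i-1} = t_j
t_{j-1}`. As for Artin monoids, the key fact is `compl_of_mul_eq`: if `a x = b y`, then `x` and `y`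
are the complements `u` and `v` times a common factor. It is proved by induction on length.
Following a chain of elementary moves between two words only requires transitivity, and this is the
cube condition on triples of generators, `ComplUpTo.trans`. The case `a = b` is left cancellation,
and the anti-automorphism `rev` gives the right-hand versions.

The `Λ_p` commute pairwise, and `x Δ = Δ φ(x)`, where `φ` lowers the index of each `t_i` by `r` and
fixes the `s_j` (`mul_delta`). Every generator divides `Δ`, so `Δ` is a Garside element and its
powers are common multiples of any given elements; hence lcm's exist, and gcd's with them.

For `e ≥ 2`, an element divisible by all generators is divisible by `Λ_2`, then by `Λ_2 Λ_3`, and so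
on up to `Δ` (`delta_dvd`). A Garside element is such an element, because its divisors generate. -/

namespace Garside

/-! ### Lcm's and gcd's in monoids with a length function -/

section Generalities

variable {M : Type*} [Monoid M]

theorem isRightLcm_pair {x y m : M} :
    IsRightLcm {x, y} m ↔ (x ∣ m ∧ y ∣ m) ∧ ∀ n, x ∣ n → y ∣ n → m ∣ n := by
  simp [IsRightLcm]

theorem isLeftGcd_pair {x y d : M} :
    IsLeftGcd {x, y} d ↔ (d ∣ x ∧ d ∣ y) ∧ ∀ c, c ∣ x → c ∣ y → c ∣ d := by
  simp [IsLeftGcd]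

/-- In a left cancellative monoid with a length function, if atoms with a common right multiple
have a right lcm, then so do all pairs of elements with a common right multiple. -/
theorem exists_rightLcm_of_dvd [IsLeftCancelMul M] (len : M → ℕ)
    (len_mul : ∀ x y, len (x * y) = len x + len y) (A : Set M) (len_pos : ∀ a ∈ A, 0 < len a)
    (hA : ∀ x : M, x = 1 ∨ ∃ a ∈ A, ∃ y, x = a * y)
    (lcmA : ∀ a ∈ A, ∀ b ∈ A, ∃ l, IsRightLcm {a, b} l) (m x y : M) (hx : x ∣ m) (hy : y ∣ m) :
    ∃ l, IsRightLcm {x, y} l := by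
  induction hn : len m using Nat.strong_induction_on generalizing m x y with
  | _ n ih =>
    subst hn
    obtain rfl | ⟨a, ha, x, rfl⟩ := hA x
    · exact ⟨y, isRightLcm_pair.2 ⟨⟨one_dvd _, dvd_rfl⟩, fun _ _ h => h⟩⟩
    obtain rfl | ⟨b, hb, y, rfl⟩ := hA y
    · exact ⟨a * x, isRightLcm_pair.2 ⟨⟨dvd_rfl, one_dvd _⟩, fun _ h _ => h⟩⟩
    obtain ⟨l, hl⟩ := lcmA a ha b hb
    obtain ⟨⟨⟨c, hac⟩, ⟨d, hbd⟩⟩, hl⟩ := isRightLcm_pair.1 hl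
    obtain ⟨k, rfl⟩ := hl m (dvd_of_mul_right_dvd hx) (dvd_of_mul_right_dvd hy)
    have pa := len_pos a ha
    have pb := len_pos b hb
    have hlen : len (l * k) = len a + len (c * k) := by rw [hac, mul_assoc, len_mul]
    have hlen' : len (l * k) = len b + len (d * k) := by rw [hbd, mul_assoc, len_mul]
    have hx' : x ∣ c * k := by
      obtain ⟨z, hz⟩ := hx
      exact ⟨z, by simpa [hac, mul_assoc] using hz⟩
    have hy' : y ∣ d * k := by
      obtain ⟨z, hz⟩ := hy
      exact ⟨z, by simpa [hbd, mul_assoc] using hz⟩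
    -- The lcm's `c * v` of `x`, `c` and `d * w` of `y`, `d` reduce the problem to `v` and `w`,
    -- which divide `k`. If `o` is the lcm of these, then `l * o` is the one sought.
    obtain ⟨p, hp⟩ := ih _ (by omega) (c * k) x c hx' (Dvd.intro _ rfl) rfl
    obtain ⟨q, hq⟩ := ih _ (by omega) (d * k) y d hy' (Dvd.intro _ rfl) rfl
    obtain ⟨⟨hxp, ⟨v, rfl⟩⟩, hp⟩ := isRightLcm_pair.1 hp
    obtain ⟨⟨hyq, ⟨w, rfl⟩⟩, hq⟩ := isRightLcm_pair.1 hq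
    have hv : v ∣ k := by
      obtain ⟨z, hz⟩ := hp (c * k) hx' (Dvd.intro _ rfl)
      exact ⟨z, by simpa [mul_assoc] using hz⟩
    have hw : w ∣ k := by
      obtain ⟨z, hz⟩ := hq (d * k) hy' (Dvd.intro _ rfl)
      exact ⟨z, by simpa [mul_assoc] using hz⟩
    have hlen'' := len_mul c k
    obtain ⟨o, ho⟩ := ih _ (by omega) k v w hv hw rfl
    obtain ⟨⟨hvo, hwo⟩, ho⟩ := isRightLcm_pair.1 ho
    refine ⟨l * o, isRightLcm_pair.2 ⟨⟨?_, ?_⟩, ?_⟩⟩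
    · rw [hac, mul_assoc]
      exact mul_dvd_mul_left _ (hxp.trans (mul_dvd_mul_left _ hvo))
    · rw [hbd, mul_assoc]
      exact mul_dvd_mul_left _ (hyq.trans (mul_dvd_mul_left _ hwo))
    · intro n hxn hyn
      obtain ⟨j, rfl⟩ := hl n (dvd_of_mul_right_dvd hxn) (dvd_of_mul_right_dvd hyn)
      refine mul_dvd_mul_left _ (ho _ ?_ ?_)
      · have h : x ∣ c * j := by
          obtain ⟨z, hz⟩ := hxn
          exact ⟨z, by simpa [hac, mul_assoc] using hz⟩
        obtain ⟨z, hz⟩ := hp _ h (Dvd.intro _ rfl)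
        exact ⟨z, by simpa [mul_assoc] using hz⟩
      · have h : y ∣ d * j := by
          obtain ⟨z, hz⟩ := hyn
          exact ⟨z, by simpa [hbd, mul_assoc] using hz⟩
        obtain ⟨z, hz⟩ := hq _ h (Dvd.intro _ rfl)
        exact ⟨z, by simpa [mul_assoc] using hz⟩

/-- A monoid with a length function and right lcm's has left gcd's. -/
theorem exists_leftGcd_of_rightLcm (len : M → ℕ)
    (len_mul : ∀ x y, len (x * y) = len x + len y) (len_eq_zero : ∀ x, len x = 0 → x = 1)
    (hlcm : ∀ x y : M, ∃ l, IsRightLcm {x, y} l) (x y : M) : ∃ d, IsLeftGcd {x, y} d := by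
  classical
  have hle : ∀ {u v : M}, u ∣ v → len u ≤ len v := by
    rintro u _ ⟨w, rfl⟩
    rw [len_mul]; omega
  let P : ℕ → Prop := fun n => ∃ d, (d ∣ x ∧ d ∣ y) ∧ len d = n
  have h0 : P (len (1 : M)) := ⟨1, ⟨one_dvd _, one_dvd _⟩, rfl⟩
  have hb : len (1 : M) ≤ len x := hle (one_dvd _)
  -- Take a longest common divisor `d`: its lcm with another one is again a common divisor, no
  -- longer than `d`, hence `d` itself.
  obtain ⟨d, ⟨hdx, hdy⟩, hd⟩ := Nat.findGreatest_spec (P := P) hb h0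
  refine ⟨d, isLeftGcd_pair.2 ⟨⟨hdx, hdy⟩, fun c hcx hcy => ?_⟩⟩
  obtain ⟨l, hl⟩ := hlcm d c
  obtain ⟨⟨⟨k, rfl⟩, hcl⟩, hl⟩ := isRightLcm_pair.1 hl
  have hlx := hl x hdx hcx
  have hmax : len (d * k) ≤ len d :=
    (Nat.le_findGreatest (P := P) (hle hlx) ⟨_, ⟨hlx, hl y hdy hcy⟩, rfl⟩).trans hd.ge
  rw [len_mul] at hmax
  rwa [len_eq_zero k (by omega), mul_one] at hcl

end Generalities

/-! ### Generators, relations by height, word length -/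

variable {e r : ℕ}

/-- A generator, as an element of the monoid. -/
abbrev gen (a : Gen e r) : BraidMonoid e r := PresentedMonoid.of (Rel e r) a

namespace Gen

/-- The height of a generator: `2` for `t_i`, and `j` for `s_j`. -/
def ht : Gen e r → ℕ
  | t _ => 2
  | s j => j

/-- The permutation `t_i ↦ t_{i-1}`, `s_j ↦ s_j` of the generators. -/
def pred : Gen e r → Gen e r
  | t i => t (i - 1)
  | s j => s j

@[simp] theorem ht_pred (a : Gen e r) : a.pred.ht = a.ht := by cases a <;> rfl

theorem pred_injective : Function.Injective (pred : Gen e r → Gen e r) := by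
  rintro (i | i) (j | j) h <;> simp_all [pred]

/-- Generators at distance at least two in the Coxeter diagram. -/
def Far (a b : Gen e r) : Prop := a.ht + 2 ≤ b.ht ∨ b.ht + 2 ≤ a.ht

/-- Adjacent generators in the Coxeter diagram. -/
def Near (a b : Gen e r) : Prop := a.ht + 1 = b.ht ∨ b.ht + 1 = a.ht

/-- Distinct generators of the same height. -/
def Twin (a b : Gen e r) : Prop := a ≠ b ∧ a.ht = b.ht

theorem Far.symm {a b : Gen e r} (h : Far a b) : Far b a := Or.symm h

theorem Near.symm {a b : Gen e r} (h : Near a b) : Near b a := Or.symm h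

theorem Twin.symm {a b : Gen e r} (h : Twin a b) : Twin b a := ⟨h.1.symm, h.2.symm⟩

theorem Twin.pred {a b : Gen e r} (h : Twin a b) : Twin a.pred b.pred :=
  ⟨pred_injective.ne h.1, by simpa using h.2⟩

/-- Distinct generators of equal height are two `t`'s, so `e ≠ 1` and `i - 1 ≠ i`. -/
theorem Twin.self_pred {a b : Gen e r} (h : Twin a b) : Twin b b.pred := by
  refine ⟨fun hb => h.1 ?_, b.ht_pred.symm⟩
  cases a with
  | t i =>
    cases b with
    | t j =>
      simp only [Gen.pred, Gen.t.injEq] at hb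
      have h1 : (1 : ZMod e) = 0 := by linear_combination hb
      have := subsingleton_of_zero_eq_one h1.symm
      rw [Subsingleton.elim i j]
    | s j => have h2 := h.2; simp only [ht] at h2; have := j.2.1; omega
  | s i =>
    cases b with
    | t j => have h2 := h.2; simp only [ht] at h2; have := i.2.1; omega
    | s j => rw [Subtype.ext h.2]

theorem Near.pred_left {a b : Gen e r} (h : Near a b) : Near a.pred b := by simpa [Near] using h

theorem Far.pred_left {a b : Gen e r} (h : Far a b) : Far a.pred b := by simpa [Far] using h

theorem Near.pred_right {a b : Gen e r} (h : Near a b) : Near a b.pred := by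
  simpa [Near] using h

theorem Far.pred_right {a b : Gen e r} (h : Far a b) : Far a b.pred := by simpa [Far] using h

theorem eq_or_twin_or_near_or_far (a b : Gen e r) : a = b ∨ Twin a b ∨ Near a b ∨ Far a b := by
  unfold Twin Near Far
  by_cases h : a = b
  · exact Or.inl h
  · right
    rcases lt_trichotomy a.ht b.ht with h' | h' | h'
    · right; omega
    · exact Or.inl ⟨h, h'⟩
    · right; omega

end Gen

open Gen

/-- Heights merge the five families of relations into three, uniform in the `t_i` and `s_j`, so that
later case analyses run over relative positions only. -/
theorem gen_far {a b : Gen e r} (h : Far a b) : gen a * gen b = gen b * gen a := by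
  cases a with
  | t i =>
    cases b with
    | t j => simp [Far, ht] at h
    | s j =>
      have hj : 4 ≤ (j : ℕ) := by simp [Far, ht] at h; have := j.2.1; omega
      exact (PresentedMonoid.mk_eq_mk_of_rel (Rel.R4 j hj i)).symm
  | s i =>
    cases b with
    | t j =>
      have hi : 4 ≤ (i : ℕ) := by simp [Far, ht] at h; have := i.2.1; omega
      exact PresentedMonoid.mk_eq_mk_of_rel (Rel.R4 i hi j)
    | s j =>
      refine PresentedMonoid.mk_eq_mk_of_rel (Rel.R2 i j ?_)
      simp only [Far, ht] at h
      rw [lt_abs]; omega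

theorem gen_near {a b : Gen e r} (h : Near a b) :
    gen a * gen b * gen a = gen b * gen a * gen b := by
  cases a with
  | t i =>
    cases b with
    | t j => simp [Near, ht] at h
    | s j =>
      have hj : (j : ℕ) = 3 := by simp [Near, ht] at h; have := j.2.1; omega
      exact (PresentedMonoid.mk_eq_mk_of_rel (Rel.R3 j hj i)).symm
  | s i =>
    cases b with
    | t j =>
      have hi : (i : ℕ) = 3 := by simp [Near, ht] at h; have := i.2.1; omega
      exact PresentedMonoid.mk_eq_mk_of_rel (Rel.R3 i hi j)
    | s j =>
      refine PresentedMonoid.mk_eq_mk_of_rel (Rel.R1 i j ?_)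
      simp only [Near, ht] at h
      rw [abs_eq (by norm_num)]; omega

theorem gen_same {a b : Gen e r} (h : a.ht = b.ht) :
    gen a * gen a.pred = gen b * gen b.pred := by
  cases a with
  | t i =>
    cases b with
    | t j => exact PresentedMonoid.mk_eq_mk_of_rel (Rel.R5 i j)
    | s j => simp only [ht] at h; have := j.2.1; omega
  | s i =>
    cases b with
    | t j => simp only [ht] at h; have := i.2.1; omega
    | s j => simp only [ht] at h; rw [Subtype.ext h]

theorem gen_far_assoc {a b : Gen e r} (h : Far a b) (x : BraidMonoid e r) :
    gen a * (gen b * x) = gen b * (gen a * x) := by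
  simp only [← mul_assoc, gen_far h]

theorem gen_near_assoc {a b : Gen e r} (h : Near a b) (x : BraidMonoid e r) :
    gen a * (gen b * (gen a * x)) = gen b * (gen a * (gen b * x)) := by
  simp only [← mul_assoc, gen_near h]

theorem gen_same_assoc {a b : Gen e r} (h : a.ht = b.ht) (x : BraidMonoid e r) :
    gen a * (gen a.pred * x) = gen b * (gen b.pred * x) := by
  simp only [← mul_assoc, gen_same h]

/-- The word length, as a homomorphism. -/
def lenHom (e r : ℕ) : BraidMonoid e r →* Multiplicative ℕ :=
  PresentedMonoid.lift (fun _ => Multiplicative.ofAdd 1) (by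
    intro a b h
    cases h <;> simp)

/-- The word length of an element. -/
def len (x : BraidMonoid e r) : ℕ := (lenHom e r x).toAdd

@[simp] theorem len_one : len (1 : BraidMonoid e r) = 0 := by simp [len]

@[simp] theorem len_mul (x y : BraidMonoid e r) : len (x * y) = len x + len y := by simp [len]

@[simp] theorem len_gen (a : Gen e r) : len (gen a) = 1 := by
  simp [len, lenHom, gen]

theorem eq_one_or_gen_mul (x : BraidMonoid e r) : x = 1 ∨ ∃ a y, x = gen a * y := by
  induction x using PresentedMonoid.inductionOn with
  | _ w =>
    cases w using FreeMonoid.casesOn with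
    | one => exact Or.inl rfl
    | of_mul a w => exact Or.inr ⟨a, PresentedMonoid.mk _ w, rfl⟩

theorem len_eq_zero (x : BraidMonoid e r) (h : len x = 0) : x = 1 := by
  obtain rfl | ⟨a, y, rfl⟩ := eq_one_or_gen_mul x
  · rfl
  · simp at h

/-- Induction on elements, multiplying by generators on the left. -/
theorem gen_mul_induction {p : BraidMonoid e r → Prop} (one : p 1)
    (mul : ∀ a y, p y → p (gen a * y)) (x : BraidMonoid e r) : p x := by
  induction hn : len x generalizing x with
  | zero => rw [len_eq_zero x hn]; exact one
  | succ n ih =>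
    obtain rfl | ⟨a, y, rfl⟩ := eq_one_or_gen_mul x
    · exact one
    · exact mul _ _ (ih _ (by simpa [add_comm] using hn))

end Garside

/-! ### Complements and the cube condition -/

namespace Garside

open Gen

variable {e r : ℕ}

/-- The elements `x` and `y` are obtained from the complements of `a` and `b` in their right lcm
by multiplication on the right by a common factor. -/
structure Compl (a b : Gen e r) (x y : BraidMonoid e r) : Prop where
  eq : a = b → x = y
  twin : Twin a b → ∃ z, x = gen a.pred * z ∧ y = gen b.pred * z
  near : Near a b → ∃ z, x = gen b * (gen a * z) ∧ y = gen a * (gen b * z)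
  far : Far a b → ∃ z, x = gen b * z ∧ y = gen a * z

namespace Compl

variable {a b c : Gen e r} {x y : BraidMonoid e r}

theorem of_eq (a : Gen e r) (x : BraidMonoid e r) : Compl a a x x where
  eq _ := rfl
  twin h := absurd rfl h.1
  near h := by unfold Near at h; omega
  far h := by unfold Far at h; omega

theorem of_twin (h : Twin a b) (hz : ∃ z, x = gen a.pred * z ∧ y = gen b.pred * z) :
    Compl a b x y where
  eq h' := absurd h' h.1
  twin _ := hz
  near h' := by unfold Near at h'; have := h.2; omega
  far h' := by unfold Far at h'; have := h.2; omega

theorem of_near (h : Near a b)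
    (hz : ∃ z, x = gen b * (gen a * z) ∧ y = gen a * (gen b * z)) : Compl a b x y where
  eq h' := by subst h'; unfold Near at h; omega
  twin h' := by unfold Near at h; have := h'.2; omega
  near _ := hz
  far h' := by unfold Near at h; unfold Far at h'; omega

theorem of_far (h : Far a b) (hz : ∃ z, x = gen b * z ∧ y = gen a * z) : Compl a b x y where
  eq h' := by subst h'; unfold Far at h; omega
  twin h' := by unfold Far at h; have := h'.2; omega
  near h' := by unfold Far at h; unfold Near at h'; omega
  far _ := hz

theorem symm (h : Compl a b x y) : Compl b a y x where
  eq h' := (h.eq h'.symm).symm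
  twin h' := let ⟨z, hx, hy⟩ := h.twin h'.symm; ⟨z, hy, hx⟩
  near h' := let ⟨z, hx, hy⟩ := h.near h'.symm; ⟨z, hy, hx⟩
  far h' := let ⟨z, hx, hy⟩ := h.far h'.symm; ⟨z, hy, hx⟩

theorem mul_right (h : Compl a b x y) (w : BraidMonoid e r) : Compl a b (x * w) (y * w) where
  eq h' := by rw [h.eq h']
  twin h' := let ⟨z, hx, hy⟩ := h.twin h'; ⟨z * w, by rw [hx, mul_assoc], by rw [hy, mul_assoc]⟩
  near h' := let ⟨z, hx, hy⟩ := h.near h'; ⟨z * w, by simp [hx, mul_assoc], by simp [hy, mul_assoc]⟩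
  far h' := let ⟨z, hx, hy⟩ := h.far h'; ⟨z * w, by rw [hx, mul_assoc], by rw [hy, mul_assoc]⟩

end Compl

/-- Common right multiples of two generators, of length at most `n`, are multiples of their lcm. -/
def ComplUpTo (e r n : ℕ) : Prop :=
  ∀ (a b : Gen e r) (x y : BraidMonoid e r), len (gen a * x) ≤ n → gen a * x = gen b * y →
    Compl a b x y

namespace ComplUpTo

variable {n : ℕ} {a b c : Gen e r} {x y u z z' : BraidMonoid e r}

theorem cancel (H : ComplUpTo e r n) (h : gen a * x = gen a * y) (hn : len (gen a * x) ≤ n) :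
    x = y := (H a a x y hn h).eq rfl

/-- In each `cube` lemma the name lists the positions of `a, c`, of `b, c` and of `a, b`. The
equation `h` equates two factorizations of one element, given by the complements of `c` with `a` and
with `b`; applying `H` to ever shorter equations resolves it. -/
theorem cube_far_far_far (H : ComplUpTo e r n) (hac : Far a c) (hbc : Far b c) (hab : Far a b)
    (h : gen a * z = gen b * z') (hn : len (gen a * z) ≤ n) :
    ∃ k, gen c * z = gen b * k ∧ gen c * z' = gen a * k := by
  obtain ⟨w, rfl, rfl⟩ := (H _ _ _ _ hn h).far hab
  exact ⟨gen c * w, gen_far_assoc hbc.symm _, gen_far_assoc hac.symm _⟩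

theorem cube_far_far_near (H : ComplUpTo e r n) (hac : Far a c) (hbc : Far b c) (hab : Near a b)
    (h : gen a * z = gen b * z') (hn : len (gen a * z) ≤ n) :
    ∃ k, gen c * z = gen b * (gen a * k) ∧ gen c * z' = gen a * (gen b * k) := by
  obtain ⟨w, rfl, rfl⟩ := (H _ _ _ _ hn h).near hab
  exact ⟨gen c * w, by rw [gen_far_assoc hbc.symm, gen_far_assoc hac.symm],
    by rw [gen_far_assoc hac.symm, gen_far_assoc hbc.symm]⟩

theorem cube_far_far_twin (H : ComplUpTo e r n) (hac : Far a c) (hbc : Far b c) (hab : Twin a b)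
    (h : gen a * z = gen b * z') (hn : len (gen a * z) ≤ n) :
    ∃ k, gen c * z = gen a.pred * k ∧ gen c * z' = gen b.pred * k := by
  obtain ⟨w, rfl, rfl⟩ := (H _ _ _ _ hn h).twin hab
  exact ⟨gen c * w, gen_far_assoc hac.symm.pred_right _, gen_far_assoc hbc.symm.pred_right _⟩

theorem cube_twin_far_far (H : ComplUpTo e r n) (hac : Twin a c) (hbc : Far b c) (hab : Far a b)
    (h : gen c.pred * z = gen b * z') (hn : len (gen c.pred * z) ≤ n) :
    ∃ k, gen a.pred * z = gen b * k ∧ gen c * z' = gen a * k := by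
  obtain ⟨w, rfl, rfl⟩ := (H _ _ _ _ hn h).far hbc.symm.pred_left
  exact ⟨gen a.pred * w, gen_far_assoc hab.pred_left _, (gen_same_assoc hac.2 _).symm⟩

theorem cube_near_far_far (H : ComplUpTo e r n) (hac : Near a c) (hbc : Far b c) (hab : Far a b)
    (h : gen a * (gen c * z) = gen b * z') (hn : len (gen a * (gen c * z)) ≤ n) :
    ∃ k, gen c * (gen a * z) = gen b * k ∧ gen c * z' = gen a * k := by
  obtain ⟨w, h₁, rfl⟩ := (H _ _ _ _ hn h).far hab
  obtain ⟨v, rfl, rfl⟩ := (H _ _ _ _ (by simp at hn ⊢; omega) h₁).far hbc.symm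
  exact ⟨gen c * (gen a * v), by rw [gen_far_assoc hab, gen_far_assoc hbc.symm],
    gen_near_assoc hac.symm _⟩

theorem cube_near_far_near (H : ComplUpTo e r n) (hac : Near a c) (hbc : Far b c) (hab : Near a b)
    (h : gen a * (gen c * z) = gen b * z') (hn : len (gen a * (gen c * z)) ≤ n) :
    ∃ k, gen c * (gen a * z) = gen b * (gen a * k) ∧ gen c * z' = gen a * (gen b * k) := by
  obtain ⟨w, h₁, rfl⟩ := (H _ _ _ _ hn h).near hab
  obtain ⟨v, rfl, h₂⟩ := (H _ _ _ _ (by simp at hn ⊢; omega) h₁).far hbc.symm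
  obtain ⟨k, rfl, rfl⟩ := (H _ _ _ _ (by simp at hn ⊢; omega) h₂.symm).near hac.symm
  refine ⟨gen c * (gen a * (gen b * k)), ?_, ?_⟩
  · rw [gen_near_assoc hab, gen_far_assoc hbc.symm, gen_far_assoc hbc k, gen_near_assoc hac.symm]
  · rw [gen_far_assoc hbc, gen_near_assoc hac.symm, gen_near_assoc hab, gen_far_assoc hbc.symm]

theorem cube_near_near_far (H : ComplUpTo e r n) (hac : Near a c) (hbc : Near b c) (hab : Far a b)
    (h : gen a * (gen c * z) = gen b * (gen c * z')) (hn : len (gen a * (gen c * z)) ≤ n) :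
    ∃ k, gen c * (gen a * z) = gen b * k ∧ gen c * (gen b * z') = gen a * k := by
  have hn' : len (gen b * (gen c * z')) ≤ n := h ▸ hn
  obtain ⟨w, h₁, h₂⟩ := (H _ _ _ _ hn h).far hab
  obtain ⟨p, rfl, rfl⟩ := (H _ _ _ _ (by simp at hn ⊢; omega) h₁).near hbc.symm
  obtain ⟨q, rfl, h₃⟩ := (H _ _ _ _ (by simp at hn' ⊢; omega) h₂).near hac.symm
  have h₄ := H.cancel h₃ (by simp at hn ⊢; omega)
  obtain ⟨k, rfl, rfl⟩ := (H _ _ _ _ (by simp at hn ⊢; omega) h₄).far hab.symm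
  refine ⟨gen c * (gen b * (gen a * (gen c * k))), ?_, ?_⟩
  · rw [gen_far_assoc hab, gen_near_assoc hac, gen_near_assoc hbc.symm]
  · rw [gen_far_assoc hab.symm, gen_near_assoc hbc, gen_near_assoc hac.symm,
      gen_far_assoc hab]

/-- Here `a`, `b` are two `t`'s and `c` is `s_3`. Braiding with `c` turns the equation between `a`
and `b` into one between `a.pred` and `b.pred`. -/
theorem cube_near_near_twin (H : ComplUpTo e r n) (hac : Near a c) (hbc : Near b c)
    (hab : Twin a b) (h : gen a * (gen c * z) = gen b * (gen c * z'))
    (hn : len (gen a * (gen c * z)) ≤ n) :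
    ∃ k, gen c * (gen a * z) = gen a.pred * k ∧ gen c * (gen b * z') = gen b.pred * k := by
  have hn' : len (gen b * (gen c * z')) ≤ n := h ▸ hn
  obtain ⟨w, h₁, h₂⟩ := (H _ _ _ _ hn h).twin hab
  obtain ⟨p, rfl, rfl⟩ := (H _ _ _ _ (by simp at hn ⊢; omega) h₁).near hac.symm.pred_right
  obtain ⟨q, rfl, h₃⟩ := (H _ _ _ _ (by simp at hn' ⊢; omega) h₂).near hbc.symm.pred_right
  have h₄ := H.cancel h₃ (by simp at hn ⊢; omega)
  obtain ⟨k, rfl, rfl⟩ := (H _ _ _ _ (by simp at hn ⊢; omega) h₄).twin hab.pred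
  refine ⟨gen c * (gen a.pred * (gen a.pred.pred * (gen c * k))), ?_, ?_⟩
  · rw [gen_same_assoc (a.ht_pred).symm, gen_near_assoc hac.pred_left.pred_left,
      gen_near_assoc hac.symm.pred_right]
  · rw [gen_same_assoc (b.ht_pred).symm, gen_near_assoc hbc.pred_left.pred_left,
      gen_near_assoc hbc.symm.pred_right, gen_same_assoc hab.pred.2]

theorem cube_twin_near_near (H : ComplUpTo e r n) (hac : Twin a c) (hbc : Near b c)
    (hab : Near a b) (h : gen c.pred * z = gen b * (gen c * z'))
    (hn : len (gen c.pred * z) ≤ n) :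
    ∃ k, gen a.pred * z = gen b * (gen a * k) ∧ gen c * (gen b * z') = gen a * (gen b * k) := by
  have hn' : len (gen b * (gen c * z')) ≤ n := h ▸ hn
  obtain ⟨w, rfl, h₁⟩ := (H _ _ _ _ hn h).near hbc.symm.pred_left
  -- As `a ≠ c`, also `c ≠ c.pred`, so `h₁` compares two distinct `t`'s.
  obtain ⟨p, rfl, h₂⟩ := (H _ _ _ _ (by simp at hn' ⊢; omega) h₁).twin hac.self_pred
  obtain ⟨k, rfl, rfl⟩ := (H _ _ _ _ (by simp at hn ⊢; omega) h₂).near hbc.pred_right.pred_right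
  refine ⟨gen a.pred * (gen b * (gen a.pred.pred * k)), ?_, ?_⟩
  · rw [gen_same_assoc hac.symm.pred.2, gen_near_assoc hab.pred_left,
      gen_near_assoc hab.symm.pred_right.pred_right, gen_same_assoc a.ht_pred]
  · rw [gen_near_assoc hbc.pred_right, gen_same_assoc hac.symm.2,
      gen_same_assoc hac.symm.pred.2, gen_near_assoc hab.pred_left]

/-- The cube condition: `Compl` is transitive as long as the lengths are controlled. -/
theorem trans (H : ComplUpTo e r n) (h₁ : Compl a c x u) (h₂ : Compl c b u y) (hn : len u ≤ n) :
    Compl a b x y := by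
  rcases a.eq_or_twin_or_near_or_far c with rfl | hac
  · rw [h₁.eq rfl]; exact h₂
  rcases c.eq_or_twin_or_near_or_far b with rfl | hcb
  · rw [← h₂.eq rfl]; exact h₁
  rcases a.eq_or_twin_or_near_or_far b with rfl | hab
  · suffices x = y by subst this; exact .of_eq _ _
    rcases hac with hac | hac | hac
    · obtain ⟨z, rfl, rfl⟩ := h₁.twin hac
      obtain ⟨z', h, rfl⟩ := h₂.twin hac.symm
      rw [H.cancel h hn]
    · obtain ⟨z, rfl, rfl⟩ := h₁.near hac
      obtain ⟨z', h, rfl⟩ := h₂.near hac.symm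
      rw [H.cancel (H.cancel h hn) (by simp at hn ⊢; omega)]
    · obtain ⟨z, rfl, rfl⟩ := h₁.far hac
      obtain ⟨z', h, rfl⟩ := h₂.far hac.symm
      rw [H.cancel h hn]
  rcases hac with hac | hac | hac
  · obtain ⟨z, rfl, rfl⟩ := h₁.twin hac
    rcases hcb with hcb | hcb | hcb
    · obtain ⟨z', h, rfl⟩ := h₂.twin hcb
      rcases hab with hab | hab | hab
      · exact .of_twin hab ⟨z, rfl, by rw [H.cancel h hn]⟩
      all_goals simp only [Twin, Near, Far] at hac hcb hab; omega
    · obtain ⟨z', h, rfl⟩ := h₂.near hcb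
      have hab : Near a b := by unfold Near at hcb ⊢; rwa [hac.2]
      exact .of_near hab (H.cube_twin_near_near hac hcb.symm hab h hn)
    · obtain ⟨z', h, rfl⟩ := h₂.far hcb
      have hab : Far a b := by unfold Far at hcb ⊢; rwa [hac.2]
      exact .of_far hab (H.cube_twin_far_far hac hcb.symm hab h hn)
  · obtain ⟨z, rfl, rfl⟩ := h₁.near hac
    rcases hcb with hcb | hcb | hcb
    · obtain ⟨z', h, rfl⟩ := h₂.twin hcb
      -- Mirror images of configurations already covered are reached by exchanging `a` and `b`.
      have hab : Near b a := by unfold Near at hac ⊢; rw [← hcb.2]; exact hac.symm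
      exact .symm (.of_near hab (H.cube_twin_near_near hcb.symm hac hab h.symm (h ▸ hn)))
    · obtain ⟨z', h, rfl⟩ := h₂.near hcb
      rcases hab with hab | hab | hab
      · exact .of_twin hab (H.cube_near_near_twin hac hcb.symm hab h hn)
      · unfold Near at *; omega
      · exact .of_far hab (H.cube_near_near_far hac hcb.symm hab h hn)
    · obtain ⟨z', h, rfl⟩ := h₂.far hcb
      rcases hab with hab | hab | hab
      · simp only [Twin, Near, Far] at hac hcb hab; omega
      · exact .of_near hab (H.cube_near_far_near hac hcb.symm hab h hn)
      · exact .of_far hab (H.cube_near_far_far hac hcb.symm hab h hn)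
  · obtain ⟨z, rfl, rfl⟩ := h₁.far hac
    rcases hcb with hcb | hcb | hcb
    · obtain ⟨z', h, rfl⟩ := h₂.twin hcb
      have hab : Far b a := by unfold Far at hac ⊢; rw [← hcb.2]; exact hac.symm
      exact .symm (.of_far hab (H.cube_twin_far_far hcb.symm hac hab h.symm (h ▸ hn)))
    · obtain ⟨z', h, rfl⟩ := h₂.near hcb
      rcases hab with hab | hab | hab
      · simp only [Twin, Near, Far] at hac hcb hab; omega
      · exact .symm (.of_near hab.symm
          (H.cube_near_far_near hcb.symm hac hab.symm h.symm (h ▸ hn)))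
      · exact .symm (.of_far hab.symm
          (H.cube_near_far_far hcb.symm hac hab.symm h.symm (h ▸ hn)))
    · obtain ⟨z', h, rfl⟩ := h₂.far hcb
      rcases hab with hab | hab | hab
      · exact .of_twin hab (H.cube_far_far_twin hac hcb.symm hab h hn)
      · exact .of_near hab (H.cube_far_far_near hac hcb.symm hab h hn)
      · exact .of_far hab (H.cube_far_far_far hac hcb.symm hab h hn)

end ComplUpTo

/-! ### From the cube condition to lcm's of generators and left cancellation -/

open FreeMonoid (of)
open PresentedMonoid (mk)

/-- Two words are compatible if both are empty, or both are nonempty and their tails are related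
by `Compl`. -/
def Compatible (u v : FreeMonoid (Gen e r)) : Prop :=
  (u = 1 ↔ v = 1) ∧ ∀ a x b y, u = of a * x → v = of b * y →
    Compl a b (mk (Rel e r) x) (mk (Rel e r) y)

theorem freeMonoid_of_mul_inj {α : Type*} {a b : α} {x y : FreeMonoid α} :
    of a * x = of b * y ↔ a = b ∧ x = y :=
  List.cons_eq_cons

theorem freeMonoid_of_mul_ne_one {α : Type*} (a : α) (x : FreeMonoid α) : of a * x ≠ 1 :=
  List.cons_ne_nil _ _

theorem compatible_of_mul_iff {a b : Gen e r} {x y : FreeMonoid (Gen e r)} :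
    Compatible (of a * x) (of b * y) ↔ Compl a b (mk (Rel e r) x) (mk (Rel e r) y) := by
  constructor
  · exact fun h => h.2 _ _ _ _ rfl rfl
  · refine fun h => ⟨by simp, fun a' x' b' y' h₁ h₂ => ?_⟩
    obtain ⟨rfl, rfl⟩ := freeMonoid_of_mul_inj.1 h₁
    obtain ⟨rfl, rfl⟩ := freeMonoid_of_mul_inj.1 h₂
    exact h

theorem Compatible.symm {u v : FreeMonoid (Gen e r)} (h : Compatible u v) : Compatible v u :=
  ⟨h.1.symm, fun _ _ _ _ h₁ h₂ => (h.2 _ _ _ _ h₂ h₁).symm⟩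

theorem Compatible.refl (u : FreeMonoid (Gen e r)) : Compatible u u := by
  cases u using FreeMonoid.casesOn with
  | one => exact ⟨Iff.rfl, fun a x b y h _ => absurd h.symm (freeMonoid_of_mul_ne_one _ _)⟩
  | of_mul a x => exact compatible_of_mul_iff.2 (.of_eq _ _)

theorem Rel.compatible {u v : FreeMonoid (Gen e r)} (h : Rel e r u v) : Compatible u v := by
  cases h with
  | R1 i j h =>
    have hij : Near (Gen.s i : Gen e r) (Gen.s j) := by
      rw [abs_eq (by norm_num)] at h
      simp only [Near, ht]; omega
    simp only [mul_assoc]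
    exact compatible_of_mul_iff.2 (.of_near hij ⟨1, by simp [gen]; rfl, by simp; rfl⟩)
  | R2 i j h =>
    have hij : Far (Gen.s i : Gen e r) (Gen.s j) := by
      rw [lt_abs] at h
      simp only [Far, ht]; omega
    exact compatible_of_mul_iff.2 (.of_far hij ⟨1, by simp; rfl, by simp; rfl⟩)
  | R3 j h i =>
    have hij : Near (Gen.s j : Gen e r) (Gen.t i) := by simp only [Near, ht]; omega
    simp only [mul_assoc]
    exact compatible_of_mul_iff.2 (.of_near hij ⟨1, by simp; rfl, by simp; rfl⟩)
  | R4 j h i =>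
    have hij : Far (Gen.s j : Gen e r) (Gen.t i) := by simp only [Far, ht]; omega
    exact compatible_of_mul_iff.2 (.of_far hij ⟨1, by simp; rfl, by simp; rfl⟩)
  | R5 i j =>
    by_cases h : i = j
    · subst h; exact .refl _
    · have hij : Twin (Gen.t i : Gen e r) (Gen.t j) := ⟨by simpa using h, rfl⟩
      exact compatible_of_mul_iff.2 (.of_twin hij ⟨1, by simp; rfl, by simp; rfl⟩)

/-- Equality in the monoid together with compatibility, for words of length at most `n + 1`. -/
def compatibleCon {n : ℕ} (H : ComplUpTo e r n) : Con (FreeMonoid (Gen e r)) where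
  r u v := mk (Rel e r) u = mk (Rel e r) v ∧ (len (mk (Rel e r) u) ≤ n + 1 → Compatible u v)
  iseqv :=
    { refl := fun u => ⟨rfl, fun _ => .refl u⟩
      symm := fun h => ⟨h.1.symm, fun hn => (h.2 (h.1 ▸ hn)).symm⟩
      trans := by
        intro u v w h₁ h₂
        refine ⟨h₁.1.trans h₂.1, fun hn => ?_⟩
        have hn' := hn
        rw [h₁.1] at hn'
        have c₁ := h₁.2 hn
        have c₂ := h₂.2 hn'
        refine ⟨c₁.1.trans c₂.1, fun a x b y hu hw => ?_⟩
        cases v using FreeMonoid.casesOn with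
        | one => exact absurd (hu ▸ c₁.1.2 rfl) (freeMonoid_of_mul_ne_one _ _)
        | of_mul c k =>
          -- The tail of the middle word is one letter shorter, hence of length at most `n`, as the
          -- cube condition requires.
          refine H.trans (c₁.2 _ _ _ _ hu rfl) (c₂.2 _ _ _ _ rfl hw) ?_
          rw [map_mul, len_mul] at hn'
          have : len (mk (Rel e r) (of c)) = 1 := len_gen c
          omega }
  mul' := by
    intro u u' v v' h₁ h₂
    refine ⟨by rw [map_mul, map_mul, h₁.1, h₂.1], fun hn => ?_⟩
    rw [map_mul, len_mul] at hn
    have c₁ := h₁.2 (by omega)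
    cases u using FreeMonoid.casesOn with
    | one => rw [c₁.1.1 rfl, one_mul, one_mul]; exact h₂.2 (by omega)
    | of_mul a x =>
      cases u' using FreeMonoid.casesOn with
      | one => exact absurd (c₁.1.2 rfl) (freeMonoid_of_mul_ne_one _ _)
      | of_mul b y =>
        rw [mul_assoc, mul_assoc, compatible_of_mul_iff, map_mul, map_mul, h₂.1]
        exact (compatible_of_mul_iff.1 c₁).mul_right _

/-- The bound `n` makes compatibility up to length `n + 1` a congruence. It contains the defining
relations, hence the congruence they generate, which is equality in the monoid. -/
theorem complUpTo (e r n : ℕ) : ComplUpTo e r n := by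
  induction n with
  | zero =>
    intro a b x y hn
    simp at hn
  | succ n H =>
    intro a b x y hn h
    induction x using PresentedMonoid.inductionOn with
    | _ x =>
      induction y using PresentedMonoid.inductionOn with
      | _ y =>
        have hle : conGen (Rel e r) ≤ compatibleCon H := Con.conGen_le.2 fun u v huv =>
          ⟨PresentedMonoid.mk_eq_mk_of_rel huv, fun _ => huv.compatible⟩
        have h' : mk (Rel e r) (of a * x) = mk (Rel e r) (of b * y) := h
        exact compatible_of_mul_iff.1 ((hle (PresentedMonoid.mk_eq_mk_iff.1 h')).2 hn)

/-- A common right multiple of two generators is a multiple of their right lcm. -/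
theorem compl_of_mul_eq {a b : Gen e r} {x y : BraidMonoid e r} (h : gen a * x = gen b * y) :
    Compl a b x y :=
  complUpTo e r _ a b x y le_rfl h

instance : IsLeftCancelMul (BraidMonoid e r) where
  mul_left_cancel x y z h := by
    induction x using gen_mul_induction with
    | one => simpa using h
    | mul a x ih => exact ih ((compl_of_mul_eq (by simpa only [mul_assoc] using h)).eq rfl)

theorem exists_rightLcm_gen (a b : Gen e r) : ∃ l, IsRightLcm {gen a, gen b} l := by
  simp only [isRightLcm_pair]
  rcases a.eq_or_twin_or_near_or_far b with rfl | h | h | h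
  · exact ⟨gen a, ⟨dvd_rfl, dvd_rfl⟩, fun n h _ => h⟩
  · refine ⟨gen a * gen a.pred, ⟨⟨_, rfl⟩, ⟨_, gen_same h.2⟩⟩, ?_⟩
    rintro n ⟨x, rfl⟩ ⟨y, hy⟩
    obtain ⟨z, rfl, -⟩ := (compl_of_mul_eq hy).twin h
    exact ⟨z, (mul_assoc _ _ _).symm⟩
  · refine ⟨gen a * gen b * gen a, ⟨⟨_, mul_assoc _ _ _⟩, ⟨gen a * gen b, ?_⟩⟩, ?_⟩
    · rw [gen_near h, mul_assoc]
    rintro n ⟨x, rfl⟩ ⟨y, hy⟩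
    obtain ⟨z, rfl, -⟩ := (compl_of_mul_eq hy).near h
    exact ⟨z, by simp only [mul_assoc]⟩
  · refine ⟨gen a * gen b, ⟨⟨_, rfl⟩, ⟨_, gen_far h⟩⟩, ?_⟩
    rintro n ⟨x, rfl⟩ ⟨y, hy⟩
    obtain ⟨z, rfl, -⟩ := (compl_of_mul_eq hy).far h
    exact ⟨z, (mul_assoc _ _ _).symm⟩

end Garside

/-! ### Symmetries, right cancellation, finiteness -/

namespace Garside

open Gen MulOpposite

variable {e r : ℕ}

namespace Gen

@[simp] theorem ht_t (i : ZMod e) : (t i : Gen e r).ht = 2 := rfl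

@[simp] theorem ht_s (j : Set.Icc 3 r) : (s j : Gen e r).ht = j := rfl

/-- The involution `t_i ↦ t_{-i}`, `s_j ↦ s_j` of the generators. -/
def neg : Gen e r → Gen e r
  | t i => t (-i)
  | s j => s j

/-- The permutation `t_i ↦ t_{i+k}`, `s_j ↦ s_j` of the generators. -/
def shift (k : ZMod e) : Gen e r → Gen e r
  | t i => t (i + k)
  | s j => s j

@[simp] theorem neg_neg (a : Gen e r) : a.neg.neg = a := by cases a <;> simp [neg]

@[simp] theorem ht_neg (a : Gen e r) : a.neg.ht = a.ht := by cases a <;> rfl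

@[simp] theorem ht_shift (k : ZMod e) (a : Gen e r) : (a.shift k).ht = a.ht := by cases a <;> rfl

theorem shift_neg_shift (k : ZMod e) (a : Gen e r) : (a.shift (-k)).shift k = a := by
  cases a <;> simp [shift]

theorem pred_shift (k : ZMod e) (a : Gen e r) : (a.shift k).pred = a.pred.shift k := by
  cases a
  · simp only [shift, pred, Gen.t.injEq]; ring
  · rfl

/-- Reversal sends `t_i t_{i-1}` to `t_{1-i} t_{-i}`, again of the form `t_j t_{j-1}`; this is what
`revHom` needs. -/
theorem pred_neg_pred (a : Gen e r) : a.pred.neg.pred = a.neg := by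
  cases a
  · simp only [neg, pred, Gen.t.injEq]; ring
  · rfl

theorem eq_of_ht_eq {a b : Gen e r} (h : a.ht = b.ht) (h3 : 3 ≤ a.ht) : a = b := by
  cases a with
  | t i => simp [ht] at h3
  | s i =>
    cases b with
    | t j => rw [h] at h3; simp [ht] at h3
    | s j => rw [Subtype.ext h]

theorem two_le_ht (a : Gen e r) : 2 ≤ a.ht := by
  cases a with
  | t i => exact le_rfl
  | s j => exact (Nat.le_succ 2).trans j.2.1

theorem ht_le (hr : 2 ≤ r) (a : Gen e r) : a.ht ≤ r := by
  cases a with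
  | t i => exact hr
  | s j => exact j.2.2

theorem finite (he : 1 ≤ e) : Finite (Gen e r) := by
  have : NeZero e := ⟨by omega⟩
  exact Finite.of_surjective (Sum.elim Gen.t Gen.s : ZMod e ⊕ Set.Icc 3 r → Gen e r) (by
    rintro (i | j)
    · exact ⟨.inl i, rfl⟩
    · exact ⟨.inr j, rfl⟩)

end Gen

/-- A map on generators which respects the three types of relations extends to the monoid. -/
def liftGen {N : Type*} [Monoid N] (f : Gen e r → N)
    (far : ∀ a b, Far a b → f a * f b = f b * f a)
    (near : ∀ a b, Near a b → f a * f b * f a = f b * f a * f b)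
    (same : ∀ a b, a.ht = b.ht → f a * f a.pred = f b * f b.pred) : BraidMonoid e r →* N :=
  PresentedMonoid.lift f (by
    intro u v h
    cases h with
    | R1 i j h =>
      simpa using near (.s i) (.s j) (by
        rw [abs_eq (by norm_num)] at h
        simp only [Near, ht]; omega)
    | R2 i j h =>
      simpa using far (.s i) (.s j) (by
        rw [lt_abs] at h
        simp only [Far, ht]; omega)
    | R3 j h i => simpa using near (.s j) (.t i) (by simp only [Near, ht]; omega)
    | R4 j h i => simpa using far (.s j) (.t i) (by simp only [Far, ht]; omega)
    | R5 i j => simpa [Gen.pred] using same (.t i) (.t j) rfl)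

/-- The automorphism `t_i ↦ t_{i+k}`, `s_j ↦ s_j` of the monoid. -/
def shiftHom (k : ZMod e) : BraidMonoid e r →* BraidMonoid e r :=
  liftGen (fun a => gen (a.shift k))
    (fun _ _ h => gen_far (by simpa [Far] using h))
    (fun _ _ h => gen_near (by simpa [Near] using h))
    (fun a b h => by rw [← pred_shift, ← pred_shift]; exact gen_same (by simpa using h))

theorem shiftHom_gen (k : ZMod e) (a : Gen e r) : shiftHom k (gen a) = gen (a.shift k) := rfl

theorem shiftHom_shiftHom_neg (k : ZMod e) (x : BraidMonoid e r) :
    shiftHom k (shiftHom (-k) x) = x := by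
  induction x using gen_mul_induction with
  | one => simp
  | mul a x ih => rw [map_mul, map_mul, ih, shiftHom_gen, shiftHom_gen, shift_neg_shift]

/-- The anti-automorphism `t_i ↦ t_{-i}`, `s_j ↦ s_j`, as a homomorphism to the opposite. -/
def revHom (e r : ℕ) : BraidMonoid e r →* (BraidMonoid e r)ᵐᵒᵖ :=
  liftGen (fun a => op (gen a.neg))
    (fun a b h => by
      rw [← op_mul, ← op_mul, gen_far (Far.symm (by simpa [Far] using h))])
    (fun a b h => by
      simp only [← op_mul, ← mul_assoc]
      rw [gen_near (by simpa [Near] using h)])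
    (fun a b h => by
      rw [← op_mul, ← op_mul, ← pred_neg_pred a, ← pred_neg_pred b,
        gen_same (a := a.pred.neg) (b := b.pred.neg) (by simpa using h)])

/-- The anti-automorphism `t_i ↦ t_{-i}`, `s_j ↦ s_j`. -/
def rev (x : BraidMonoid e r) : BraidMonoid e r := (revHom e r x).unop

@[simp] theorem rev_one : rev (1 : BraidMonoid e r) = 1 := by simp [rev]

@[simp] theorem rev_mul (x y : BraidMonoid e r) : rev (x * y) = rev y * rev x := by simp [rev]

@[simp] theorem rev_gen (a : Gen e r) : rev (gen a) = gen a.neg := rfl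

@[simp] theorem rev_rev (x : BraidMonoid e r) : rev (rev x) = x := by
  induction x using gen_mul_induction with
  | one => simp
  | mul a x ih => simp [ih]

@[simp] theorem len_rev (x : BraidMonoid e r) : len (rev x) = len x := by
  induction x using gen_mul_induction with
  | one => simp
  | mul a x ih => simp [ih, add_comm]

theorem rightDvd_iff {x y : BraidMonoid e r} : RightDvd x y ↔ rev x ∣ rev y := by
  constructor
  · rintro ⟨z, rfl⟩
    exact ⟨rev z, by simp⟩
  · rintro ⟨z, hz⟩
    exact ⟨rev z, by rw [← rev_rev y, hz, rev_mul, rev_rev]⟩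

theorem rightDvd_iff_dvd_rev {x y : BraidMonoid e r} : RightDvd x (rev y) ↔ rev x ∣ y := by
  rw [rightDvd_iff, rev_rev]

theorem IsRightLcm.rev_pair {x y m : BraidMonoid e r} (h : IsRightLcm {rev x, rev y} m) :
    IsLeftLcm {x, y} (rev m) := by
  obtain ⟨⟨hx, hy⟩, hm⟩ := isRightLcm_pair.1 h
  simp only [IsLeftLcm, Set.mem_insert_iff, Set.mem_singleton_iff, forall_eq_or_imp, forall_eq]
  exact ⟨⟨rightDvd_iff_dvd_rev.2 hx, rightDvd_iff_dvd_rev.2 hy⟩, fun n ⟨h₁, h₂⟩ =>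
    rightDvd_iff.2 (by rw [rev_rev]; exact hm _ (rightDvd_iff.1 h₁) (rightDvd_iff.1 h₂))⟩

theorem IsLeftGcd.rev_pair {x y d : BraidMonoid e r} (h : IsLeftGcd {rev x, rev y} d) :
    IsRightGcd {x, y} (rev d) := by
  obtain ⟨⟨hx, hy⟩, hd⟩ := isLeftGcd_pair.1 h
  simp only [IsRightGcd, Set.mem_insert_iff, Set.mem_singleton_iff, forall_eq_or_imp, forall_eq]
  exact ⟨⟨rightDvd_iff.2 (by rwa [rev_rev]), rightDvd_iff.2 (by rwa [rev_rev])⟩, fun n ⟨h₁, h₂⟩ =>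
    rightDvd_iff_dvd_rev.2 (hd _ (rightDvd_iff.1 h₁) (rightDvd_iff.1 h₂))⟩

instance : IsRightCancelMul (BraidMonoid e r) where
  mul_right_cancel x y z h := by
    have h' := congrArg rev h
    simp only [rev_mul] at h'
    rw [← rev_rev y, mul_left_cancel h', rev_rev]

theorem finite_len_le (he : 1 ≤ e) (n : ℕ) : {x : BraidMonoid e r | len x ≤ n}.Finite := by
  have := Gen.finite (r := r) he
  induction n with
  | zero => exact (Set.finite_singleton 1).subset fun x hx => len_eq_zero x (Nat.le_zero.1 hx)
  | succ n ih =>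
    refine ((Set.finite_singleton 1).union
      (Set.Finite.image2 (· * ·) (Set.finite_range gen) ih)).subset fun x hx => ?_
    obtain rfl | ⟨a, y, rfl⟩ := eq_one_or_gen_mul x
    · exact Or.inl rfl
    · refine Or.inr ⟨gen a, ⟨a, rfl⟩, y, ?_, rfl⟩
      simp at hx ⊢; omega

/-! ### Commutation rules for `Λ_p` and `Δ` -/

theorem tau_eq {a : Gen e r} (h : a.ht = 2) : tau e r = gen a * gen a.pred := by
  rw [gen_same (b := Gen.t 1) h]
  simp [tau, t, Gen.pred, gen]

/-- Both sides are `t_i t_{i-1} t_{i-2}`. -/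
theorem gen_mul_tau {a : Gen e r} (h : a.ht = 2) :
    gen a * tau e r = tau e r * gen a.pred.pred := by
  rw [tau_eq h, mul_assoc (gen a), gen_same (a := a) (b := a.pred) (by simp)]

/-- The generator `s_{k+3}`. -/
abbrev sGen (e : ℕ) {r k : ℕ} (hk : k + 1 + 2 ≤ r) : Gen e r := Gen.s ⟨k + 3, by simp; omega⟩

theorem lam_succ {k : ℕ} (hk : k + 1 + 2 ≤ r) :
    Lam e r (k + 1) hk =
      gen (sGen e hk) * Lam e r k (by omega) * gen (sGen e hk) := rfl

theorem commute_lam_of_lt {a : Gen e r} {k : ℕ} (hk : k + 2 ≤ r) (h : k + 4 ≤ a.ht) :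
    Commute (gen a) (Lam e r k hk) := by
  induction k with
  | zero =>
    exact .mul_right (gen_far (Or.inr h)) (gen_far (Or.inr h))
  | succ k ih =>
    have hs : Commute (gen a) (gen (sGen e hk)) :=
      gen_far (Or.inr (by rw [ht_s]; simp; omega))
    rw [lam_succ]
    exact (hs.mul_right (ih _ (by omega))).mul_right hs

/-- The critical case is `s_{p-1}` against `Λ_p = s_p s_{p-1} Λ_{p-2} s_{p-1} s_p`: a braid move
turns it into `s_p`, which crosses `Λ_{p-2}`, and a second one turns it back. -/
theorem commute_lam_of_gt {a : Gen e r} {k : ℕ} (hk : k + 2 ≤ r) (h3 : 3 ≤ a.ht)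
    (h : a.ht < k + 2) : Commute (gen a) (Lam e r k hk) := by
  induction k with
  | zero => omega
  | succ k ih =>
    rcases Nat.lt_or_ge a.ht (k + 2) with h' | h'
    · have hs : Commute (gen a) (gen (sGen e hk)) :=
        gen_far (Or.inl (by rw [ht_s]; simp; omega))
      rw [lam_succ]
      exact (hs.mul_right (ih _ h')).mul_right hs
    · obtain ⟨k, rfl⟩ : ∃ j, k = j + 1 := ⟨k - 1, by omega⟩
      have hk' : k + 1 + 2 ≤ r := by omega
      obtain rfl : a = sGen e hk' := eq_of_ht_eq (by rw [ht_s]; simp; omega) h3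
      rw [lam_succ, lam_succ hk']
      have hc := commute_lam_of_lt (a := sGen e hk) (k := k) (by omega) (by simp)
      have hb : Near (sGen e hk') (sGen e hk) := Or.inl (by simp)
      have hb' := gen_near hb
      simp only [Commute, SemiconjBy, mul_assoc] at hb' hc ⊢
      rw [gen_near_assoc hb, ← mul_assoc _ (Lam e r k _), hc, mul_assoc, ← hb']

/-- With `τ = t_i t_{i-1}`, two braid moves carry `t_i` across `s_3 τ s_3` and leave `t_{i-1}`; the
higher `s_j` commute with both. -/
theorem gen_mul_lam_succ {a : Gen e r} (ha : a.ht = 2) {k : ℕ} (hk : k + 1 + 2 ≤ r) :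
    gen a * Lam e r (k + 1) hk = Lam e r (k + 1) hk * gen a.pred := by
  induction k with
  | zero =>
    rw [lam_succ]
    change gen a * (_ * tau e r * _) = _ * tau e r * _ * _
    have hb : Near a (sGen e hk) := Or.inl (by simp [ha])
    have hb' := gen_near hb.pred_left
    rw [tau_eq ha]
    simp only [mul_assoc] at hb' ⊢
    rw [gen_near_assoc hb, hb']
  | succ k ih =>
    have hs : Far a (sGen e hk) := Or.inl (by rw [ht_s]; simp; omega)
    rw [lam_succ]
    calc gen a * (gen (sGen e hk) * Lam e r (k + 1) _ * gen (sGen e hk))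
        = gen (sGen e hk) * (gen a * Lam e r (k + 1) (by omega)) * gen (sGen e hk) := by
          simp only [← mul_assoc, gen_far hs]
      _ = _ := by simp only [ih, mul_assoc, gen_far hs.pred_left]

theorem commute_tau_lam {k : ℕ} (hk : k + 1 + 2 ≤ r) :
    Commute (tau e r) (Lam e r (k + 1) hk) := by
  have h0 : (Gen.t 0 : Gen e r).ht = 2 := rfl
  have h1 : (Gen.t 0 : Gen e r).pred.ht = 2 := rfl
  change _ * _ = _ * _
  nth_rw 1 [tau_eq h0]
  rw [mul_assoc, gen_mul_lam_succ h1, ← mul_assoc, gen_mul_lam_succ h0, mul_assoc, ← tau_eq h1]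

theorem commute_lam_lam {i j : ℕ} (hi : i + 2 ≤ r) (hj : j + 2 ≤ r) (hij : i < j) :
    Commute (Lam e r i hi) (Lam e r j hj) := by
  induction i with
  | zero =>
    obtain ⟨j, rfl⟩ : ∃ k, j = k + 1 := ⟨j - 1, by omega⟩
    exact commute_tau_lam hj
  | succ i ih =>
    have hs := commute_lam_of_gt (a := sGen e hi) hj (by simp) (by simp; omega)
    rw [lam_succ]
    exact (hs.mul_left (ih _ (by omega))).mul_left hs

/-- The partial product `Λ_2 ⋯ Λ_{n+1}`. -/
def lamProd (e r : ℕ) : (n : ℕ) → n + 1 ≤ r → BraidMonoid e r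
  | 0, _ => 1
  | n + 1, h => lamProd e r n (by omega) * Lam e r n (by omega)

theorem lamProd_succ {n : ℕ} (hn : n + 1 + 1 ≤ r) :
    lamProd e r (n + 1) hn = lamProd e r n (by omega) * Lam e r n hn := rfl

theorem lamProd_eq_prod {n : ℕ} (hn : n + 1 ≤ r) :
    (List.ofFn fun k : Fin n => Lam e r k (by omega)).prod = lamProd e r n hn := by
  induction n with
  | zero => simp [lamProd]
  | succ n ih =>
    rw [List.ofFn_succ', List.concat_eq_append, List.prod_append, List.prod_singleton,
      lamProd_succ]
    exact congrArg (· * _) (ih _)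

theorem delta_eq_lamProd {n : ℕ} : Delta e (n + 2) = lamProd e (n + 2) (n + 1) le_rfl :=
  lamProd_eq_prod _

theorem commute_lamProd_of_lt {a : Gen e r} {n : ℕ} (hn : n + 1 ≤ r) (h : n + 3 ≤ a.ht) :
    Commute (gen a) (lamProd e r n hn) := by
  induction n with
  | zero => exact Commute.one_right _
  | succ n ih => exact (ih _ (by omega)).mul_right (commute_lam_of_lt _ (by omega))

theorem commute_lamProd_lam {n k : ℕ} (hn : n + 1 ≤ r) (hk : k + 2 ≤ r) (h : n ≤ k) :
    Commute (lamProd e r n hn) (Lam e r k hk) := by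
  induction n with
  | zero => exact Commute.one_left _
  | succ n ih => exact (ih _ (by omega)).mul_left (commute_lam_lam _ _ (by omega))

/-- The top generator `s_p` commutes with `Λ_{p-1} Λ_p = Λ_p Λ_{p-1}`, since `s_p Λ_{p-1} Λ_p` and
`Λ_p Λ_{p-1} s_p` both equal `s_p Λ_{p-1} s_p Λ_{p-1} s_p`. -/
theorem commute_lamProd_of_ge {a : Gen e r} {n : ℕ} (hn : n + 1 ≤ r) (h3 : 3 ≤ a.ht)
    (h : a.ht ≤ n + 1) : Commute (gen a) (lamProd e r n hn) := by
  induction n with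
  | zero => omega
  | succ n ih =>
    rcases Nat.lt_or_ge a.ht (n + 2) with h' | h'
    · exact (ih _ (by omega)).mul_right (commute_lam_of_gt _ h3 h')
    · obtain ⟨n, rfl⟩ : ∃ j, n = j + 1 := ⟨n - 1, by omega⟩
      obtain rfl : a = sGen e hn := eq_of_ht_eq (by rw [ht_s]; simp; omega) h3
      rw [lamProd_succ, lamProd_succ, mul_assoc]
      refine (commute_lamProd_of_lt _ (by simp)).mul_right ?_
      have hc := commute_lam_lam (e := e) (i := n) (by omega) hn (Nat.lt_succ_self n)
      change _ * _ = _ * _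
      rw [hc.eq]
      nth_rw 1 [← hc.eq]
      rw [lam_succ]
      simp only [mul_assoc]

/-- Crossing `τ` lowers the index by two, and crossing each of the `n` other factors lowers it by
one. -/
theorem t_mul_lamProd {n : ℕ} (hn : n + 1 + 1 ≤ r) (i : ZMod e) :
    gen (Gen.t i) * lamProd e r (n + 1) hn =
      lamProd e r (n + 1) hn * gen (Gen.t (i - ((n : ZMod e) + 2))) := by
  induction n with
  | zero =>
    have h := gen_mul_tau (r := r) (a := Gen.t i) rfl
    have h' : i - 1 - 1 = i - (((0 : ℕ) : ZMod e) + 2) := by push_cast; ring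
    simp only [Gen.pred, h'] at h
    simpa [lamProd, Lam] using h
  | succ n ih =>
    rw [lamProd_succ, ← mul_assoc, ih, mul_assoc, gen_mul_lam_succ rfl, ← mul_assoc]
    congr 2
    rw [Gen.pred, Gen.t.injEq]
    push_cast
    ring

theorem gen_dvd_lam {a : Gen e r} {k : ℕ} (hk : k + 2 ≤ r) (h : a.ht = k + 2) :
    gen a ∣ Lam e r k hk := by
  cases k with
  | zero => exact ⟨_, tau_eq h⟩
  | succ k =>
    obtain rfl : a = sGen e hk := eq_of_ht_eq (by rw [ht_s]; simp; omega) (by omega)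
    exact ⟨_, by rw [lam_succ, mul_assoc]⟩

theorem gen_dvd_lamProd {a : Gen e r} {n : ℕ} (hn : n + 1 ≤ r) (h : a.ht ≤ n + 1) :
    gen a ∣ lamProd e r n hn := by
  induction n with
  | zero => have := a.two_le_ht; omega
  | succ n ih =>
    rcases Nat.lt_or_ge a.ht (n + 2) with h' | h'
    · exact (ih _ (by omega)).mul_right _
    -- The last factor commutes with the others and can be moved to the front.
    · rw [lamProd_succ, (commute_lamProd_lam _ _ le_rfl).eq]
      exact (gen_dvd_lam _ (by omega)).mul_right _

theorem gen_dvd_delta (hr : 2 ≤ r) (a : Gen e r) : gen a ∣ Delta e r := by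
  obtain ⟨n, rfl⟩ : ∃ n, r = n + 2 := ⟨r - 2, by omega⟩
  rw [delta_eq_lamProd]
  exact gen_dvd_lamProd _ (a.ht_le hr)

theorem gen_mul_delta (hr : 2 ≤ r) (a : Gen e r) :
    gen a * Delta e r = Delta e r * gen (a.shift (-(r : ZMod e))) := by
  obtain ⟨n, rfl⟩ : ∃ n, r = n + 2 := ⟨r - 2, by omega⟩
  rw [delta_eq_lamProd]
  cases a with
  | t i => rw [t_mul_lamProd]; simp [Gen.shift, sub_eq_add_neg]
  | s j => exact commute_lamProd_of_ge _ j.2.1 j.2.2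

theorem mul_delta (hr : 2 ≤ r) (x : BraidMonoid e r) :
    x * Delta e r = Delta e r * shiftHom (-(r : ZMod e)) x := by
  induction x using gen_mul_induction with
  | one => simp
  | mul a x ih =>
    rw [mul_assoc, ih, ← mul_assoc, gen_mul_delta hr, mul_assoc, map_mul, shiftHom_gen]

/-! ### The Garside structure -/

theorem isGarsideElement_delta (he : 1 ≤ e) (hr : 2 ≤ r) : IsGarsideElement (Delta e r) where
  balanced x := by
    constructor
    · rintro ⟨y, hy⟩
      -- `Δ Δ = Δ φ(Δ)`, so `φ` fixes `Δ`, and so does its inverse.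
      have hD : shiftHom (r : ZMod e) (Delta e r) = Delta e r := by
        have h := mul_left_cancel (mul_delta (e := e) hr (Delta e r))
        conv_lhs => rw [h]
        exact shiftHom_shiftHom_neg _ _
      -- Cancel `x` in `x Δ = Δ φ(x) = x y φ(x)`.
      have h : Delta e r = y * shiftHom (-(r : ZMod e)) x :=
        mul_left_cancel (a := x) (by rw [mul_delta hr, ← mul_assoc, ← hy])
      refine ⟨shiftHom (r : ZMod e) y, ?_⟩
      conv_lhs => rw [← hD, h, map_mul, shiftHom_shiftHom_neg]
    · rintro ⟨z, hz⟩
      exact ⟨shiftHom (-(r : ZMod e)) z,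
        mul_left_cancel (a := z) (by rw [mul_delta hr, ← mul_assoc, ← hz])⟩
  finite := (finite_len_le he (len (Delta e r))).subset (by
    rintro x ⟨y, hy⟩
    simp [hy])
  generates := by
    rw [eq_top_iff, ← PresentedMonoid.closure_range_of]
    refine Submonoid.closure_mono ?_
    rintro _ ⟨a, rfl⟩
    exact gen_dvd_delta hr a

theorem dvd_delta_pow (hr : 2 ≤ r) (x : BraidMonoid e r) : ∃ k : ℕ, x ∣ Delta e r ^ k := by
  induction x using gen_mul_induction with
  | one => exact ⟨0, one_dvd _⟩
  | mul a x ih =>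
    obtain ⟨k, y, hy⟩ := ih
    have hk : ∀ k : ℕ, ∃ b, gen a * Delta e r ^ k = Delta e r ^ k * gen b := by
      intro k
      induction k with
      | zero => exact ⟨a, by simp⟩
      | succ k ih =>
        obtain ⟨b, hb⟩ := ih
        exact ⟨_, by rw [pow_succ, ← mul_assoc, hb, mul_assoc, gen_mul_delta hr, mul_assoc]⟩
    obtain ⟨b, hb⟩ := hk k
    obtain ⟨z, hz⟩ := gen_dvd_delta hr b
    refine ⟨k + 1, y * z, ?_⟩
    calc Delta e r ^ (k + 1) = Delta e r ^ k * gen b * z := by rw [pow_succ, mul_assoc, ← hz]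
      _ = gen a * x * (y * z) := by rw [← hb, hy]; simp only [mul_assoc]

theorem exists_rightLcm (hr : 2 ≤ r) (x y : BraidMonoid e r) : ∃ m, IsRightLcm {x, y} m := by
  obtain ⟨j, hj⟩ := dvd_delta_pow hr x
  obtain ⟨k, hk⟩ := dvd_delta_pow hr y
  refine exists_rightLcm_of_dvd len len_mul (Set.range gen) ?_ ?_ ?_ (Delta e r ^ (j + k)) x y
    (hj.trans (pow_dvd_pow _ (Nat.le_add_right _ _)))
    (hk.trans (pow_dvd_pow _ (Nat.le_add_left _ _)))
  · rintro _ ⟨a, rfl⟩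
    simp
  · intro x
    obtain rfl | ⟨a, y, rfl⟩ := eq_one_or_gen_mul x
    · exact Or.inl rfl
    · exact Or.inr ⟨_, ⟨a, rfl⟩, y, rfl⟩
  · rintro _ ⟨a, rfl⟩ _ ⟨b, rfl⟩
    exact exists_rightLcm_gen a b

theorem isGarsideMonoid (he : 1 ≤ e) (hr : 2 ≤ r) : IsGarsideMonoid (BraidMonoid e r) where
  cancel := {}
  eq_one_of_isUnit u hu := by
    obtain ⟨v, hv⟩ := hu.exists_right_inv
    have h := congrArg len hv
    rw [len_mul, len_one] at h
    exact len_eq_zero u (by omega)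
  exists_rightLcm := exists_rightLcm hr
  exists_leftLcm x y := let ⟨_, hm⟩ := exists_rightLcm hr (rev x) (rev y); ⟨_, hm.rev_pair⟩
  exists_leftGcd := exists_leftGcd_of_rightLcm len len_mul len_eq_zero (exists_rightLcm hr)
  exists_rightGcd x y :=
    let ⟨_, hd⟩ := exists_leftGcd_of_rightLcm len len_mul len_eq_zero (exists_rightLcm hr)
      (rev x) (rev y)
    ⟨_, hd.rev_pair⟩
  exists_garsideElement := ⟨_, isGarsideElement_delta he hr⟩

/-! ### `Δ` as lcm of the generators, and minimality -/

/-- A generator far from `Λ_2, …, Λ_{k+2}` dividing a right multiple of `Λ_{k+2}` divides the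
cofactor. -/
theorem eq_mul_of_lam_mul_eq {a : Gen e r} {k : ℕ} (hk : k + 2 ≤ r) (h : k + 4 ≤ a.ht)
    {x y : BraidMonoid e r} (hxy : Lam e r k hk * x = gen a * y) :
    ∃ v, x = gen a * v ∧ y = Lam e r k hk * v := by
  suffices ∃ v, x = gen a * v by
    obtain ⟨v, rfl⟩ := this
    refine ⟨v, rfl, mul_left_cancel (a := gen a) ?_⟩
    rw [← hxy, ← mul_assoc, ← mul_assoc, (commute_lam_of_lt hk h).eq]
  induction k generalizing x y with
  | zero =>
    change t e r 1 * t e r 0 * x = _ at hxy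
    rw [mul_assoc] at hxy
    have hf : ∀ i, Far (Gen.t i) a := fun i => Or.inl h
    obtain ⟨z, hz, -⟩ := (compl_of_mul_eq hxy).far (hf 1)
    obtain ⟨w, hw, -⟩ := (compl_of_mul_eq hz).far (hf 0)
    exact ⟨w, hw⟩
  | succ k ih =>
    have hf : Far (sGen e hk) a := Or.inl (by rw [ht_s]; simp; omega)
    rw [lam_succ, mul_assoc, mul_assoc] at hxy
    obtain ⟨z, hz, -⟩ := (compl_of_mul_eq hxy).far hf
    obtain ⟨w, hw⟩ := ih _ (by omega) hz
    obtain ⟨v, hv, -⟩ := (compl_of_mul_eq hw).far hf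
    exact ⟨v, hv⟩

theorem dvd_of_lamProd_mul_eq {a : Gen e r} {n : ℕ} (hn : n + 1 ≤ r) (h : n + 3 ≤ a.ht)
    {x y : BraidMonoid e r} (hxy : lamProd e r n hn * x = gen a * y) : gen a ∣ x := by
  induction n generalizing x y with
  | zero => exact ⟨y, by simpa [lamProd] using hxy⟩
  | succ n ih =>
    rw [lamProd_succ, mul_assoc] at hxy
    obtain ⟨z, hz⟩ := ih _ (by omega) hxy
    obtain ⟨v, hv, -⟩ := eq_mul_of_lam_mul_eq _ (by omega) hz
    exact ⟨v, hv⟩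

theorem twin_t_pred (he : 2 ≤ e) (i : ZMod e) : Twin (Gen.t i : Gen e r) (Gen.t (i - 1)) := by
  have : Fact (1 < e) := ⟨he⟩
  refine ⟨fun h => ?_, rfl⟩
  rw [Gen.t.injEq] at h
  exact one_ne_zero (α := ZMod e) (by linear_combination h)

/-- `Λ_p Λ_{p+1}` left-divides the common right multiples of `Λ_p` and `s_{p+1}`. -/
theorem lam_succ_dvd (he : 2 ≤ e) {k : ℕ} (hk : k + 1 + 2 ≤ r) {x y : BraidMonoid e r}
    (h : Lam e r k (by omega) * x = gen (sGen e hk) * y) : Lam e r (k + 1) hk ∣ x := by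
  induction k generalizing x y with
  | zero =>
    have h10 : Twin (Gen.t 1 : Gen e r) (Gen.t 0) := by simpa using twin_t_pred he 1
    change gen (Gen.t 1) * gen (Gen.t 0) * x = _ at h
    have hb : ∀ i, Near (Gen.t i) (sGen e hk) := fun i => Or.inl (by simp)
    rw [mul_assoc] at h
    obtain ⟨y₁, h₁, -⟩ := (compl_of_mul_eq h).near (hb 1)
    obtain ⟨w, rfl, h₂⟩ := (compl_of_mul_eq h₁).near (hb 0)
    -- Here `t_1 ≠ t_0` is essential: it produces `t_{-1}`, which completes `s_3 t_0 t_{-1} s_3 =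
    -- Λ_3`.
    obtain ⟨u, rfl, h₃⟩ := (compl_of_mul_eq h₂).twin h10
    obtain ⟨v, rfl, -⟩ := (compl_of_mul_eq h₃).near (hb (0 - 1)).symm
    refine ⟨v, ?_⟩
    rw [lam_succ]
    change _ = _ * tau e r * _ * _
    rw [tau_eq (a := Gen.t 0) rfl]
    simp only [Gen.pred, mul_assoc]
  | succ k ih =>
    have hk' : k + 1 + 2 ≤ r := by omega
    have hb : Near (sGen e hk') (sGen e hk) := Or.inl (by simp)
    have hf : k + 4 ≤ (sGen e hk).ht := by simp
    rw [lam_succ hk', mul_assoc, mul_assoc] at h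
    obtain ⟨y₁, h₁, -⟩ := (compl_of_mul_eq h).near hb
    obtain ⟨w, h₂, h₃⟩ := eq_mul_of_lam_mul_eq _ hf h₁
    obtain ⟨u, rfl, rfl⟩ := (compl_of_mul_eq h₂).near hb
    -- With `p = k + 3`, `h₃` is a common multiple of `Λ_{p-1}` and `s_p`, with cofactor `s_p
    -- s_{p+1} u`.
    obtain ⟨m, hm⟩ := ih hk' h₃.symm
    rw [lam_succ, mul_assoc, mul_assoc] at hm
    obtain ⟨v, h₄, rfl⟩ := eq_mul_of_lam_mul_eq _ hf (mul_left_cancel hm).symm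
    obtain ⟨z, -, rfl⟩ := (compl_of_mul_eq h₄).near hb
    exact ⟨z, by rw [lam_succ, lam_succ hk']; simp only [mul_assoc]⟩

/-- Write `m = Λ_2 ⋯ Λ_{p-1} x`. As `s_p` divides `m` and passes `Λ_2, …, Λ_{p-2}`, it divides
`Λ_{p-1} x`, which forces `Λ_p` to divide `x`. -/
theorem lamProd_dvd (he : 2 ≤ e) {m : BraidMonoid e r} (hm : ∀ a : Gen e r, gen a ∣ m) {n : ℕ}
    (hn : n + 1 ≤ r) : lamProd e r n hn ∣ m := by
  induction n with
  | zero => exact one_dvd _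
  | succ n ih =>
    cases n with
    | zero =>
      obtain ⟨x, hx⟩ := hm (Gen.t 1)
      obtain ⟨y, hy⟩ := hm (Gen.t 0)
      have h10 : Twin (Gen.t 1 : Gen e r) (Gen.t 0) := by simpa using twin_t_pred he 1
      obtain ⟨z, rfl, -⟩ := (compl_of_mul_eq (hx.symm.trans hy)).twin h10
      exact ⟨z, by rw [hx, ← mul_assoc, ← tau_eq (a := Gen.t 1) rfl]; simp [lamProd, Lam]⟩
    | succ n =>
      obtain ⟨x, hx⟩ := ih (by omega)
      obtain ⟨y, hy⟩ := hm (sGen e hn)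
      have h := hx.symm.trans hy
      rw [lamProd_succ, mul_assoc] at h
      obtain ⟨z, hz⟩ := dvd_of_lamProd_mul_eq _ (by simp) h
      rw [lamProd_succ, hx]
      exact mul_dvd_mul_left _ (lam_succ_dvd he hn hz)

theorem delta_dvd (he : 2 ≤ e) (hr : 2 ≤ r) {m : BraidMonoid e r}
    (hm : ∀ a : Gen e r, gen a ∣ m) : Delta e r ∣ m := by
  obtain ⟨n, rfl⟩ : ∃ n, r = n + 2 := ⟨r - 2, by omega⟩
  rw [delta_eq_lamProd]
  exact lamProd_dvd he hm _

theorem isRightLcm_delta (he : 2 ≤ e) (hr : 2 ≤ r) :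
    IsRightLcm (generators e r) (Delta e r) := by
  simp only [IsRightLcm, generators, Set.forall_mem_range]
  exact ⟨gen_dvd_delta hr, fun _ => delta_dvd he hr⟩

/-- All generators right-divide `Δ`, hence left-divide `rev Δ`; so `Δ` divides `rev Δ`, which has
the same length. -/
theorem rev_delta (he : 2 ≤ e) (hr : 2 ≤ r) : rev (Delta e r) = Delta e r := by
  have h : Delta e r ∣ rev (Delta e r) := delta_dvd he hr fun a => by
    have h := ((isGarsideElement_delta (by omega) hr).balanced (gen a.neg)).1
      (gen_dvd_delta hr a.neg)
    simpa using rightDvd_iff.1 h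
  obtain ⟨z, hz⟩ := h
  have hl := congrArg len hz
  rw [len_rev, len_mul] at hl
  rw [hz, len_eq_zero z (by omega), mul_one]

theorem isLeftLcm_delta (he : 2 ≤ e) (hr : 2 ≤ r) :
    IsLeftLcm (generators e r) (Delta e r) := by
  have hG := isGarsideElement_delta (r := r) (show 1 ≤ e by omega) hr
  simp only [IsLeftLcm, generators, Set.forall_mem_range]
  refine ⟨fun a => (hG.balanced _).1 (gen_dvd_delta hr a), fun m hm => ?_⟩
  rw [rightDvd_iff, rev_delta he hr]
  exact delta_dvd he hr fun a => by simpa using rightDvd_iff.1 (hm a.neg)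

/-- Generators divide every Garside element. -/
theorem IsGarsideElement.gen_dvd {g : BraidMonoid e r} (hg : IsGarsideElement g) (a : Gen e r) :
    gen a ∣ g := by
  -- A product of length at most one has a trivial factor, so a generator can arise from divisors of
  -- `g` only by being one.
  have key : ∀ x ∈ Submonoid.closure {x : BraidMonoid e r | x ∣ g}, len x ≤ 1 → x ∣ g := by
    intro x hx
    induction hx using Submonoid.closure_induction with
    | mem x hx => exact fun _ => hx
    | one => exact fun _ => one_dvd _
    | mul x y _ _ ihx ihy =>
      intro h
      rw [len_mul] at h
      obtain h' | h' : len x = 0 ∨ len y = 0 := by omega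
      · rw [len_eq_zero x h', one_mul]; exact ihy (by omega)
      · rw [len_eq_zero y h', mul_one]; exact ihx (by omega)
  exact key _ (by rw [hg.generates]; trivial) (by simp)

end Garside

theorem theorem3p2 (e r : ℕ) (he : 1 ≤ e) (hr : 2 ≤ r) :
    Garside.IsGarsideMonoid (Garside.BraidMonoid e r) ∧
    Garside.IsGarsideElement (Garside.Delta e r) ∧
    (2 ≤ e →
      Garside.IsRightLcm (Garside.generators e r) (Garside.Delta e r) ∧
      Garside.IsLeftLcm (Garside.generators e r) (Garside.Delta e r) ∧
      ∀ g : Garside.BraidMonoid e r, Garside.IsGarsideElement g → Garside.Delta e r ∣ g) :=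
  ⟨Garside.isGarsideMonoid he hr, Garside.isGarsideElement_delta he hr, fun he' =>
    ⟨Garside.isRightLcm_delta he' hr, Garside.isLeftLcm_delta he' hr,
      fun _ hg => Garside.delta_dvd he' hr hg.gen_dvd⟩⟩
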